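/- For an entire function $f$, let $M(r)=\max\{|f(z)|:|z|\le r\}$, and define the order of $f$ by $\limsup_{r\to\infty}\frac{\log\log M(r)}{\log r}$ (constant functions have order $0$). Let $f$ be an entire function of order $\rho_0$ with $0\le\rho_0<1$, and suppose that all its zeros, if any, are negative real numbers. Then for every real $\rho$ with $\rho_0<\rho<1$ the integral $\int_0^\infty \frac{f'(x)}{f(x)}\,\frac{dx}{x^{\rho}}$ converges absolutely and is real, and for every $z\in\mathbb{C}$ with $|\arg z|<\frac{\pi}{2}$, $$1\le\left|\frac{f(\operatorname{Re} z)}{f(0)}\right|\le\left|\frac{f(z)}{f(0)}\right|\le\exp\left(\frac{(\rho/e)^{\rho}\,|z|^{\rho}}{\cos^{1-\rho}(\arg z)\,\Gamma(1+\rho)}\int_0^\infty\frac{f'(x)}{f(x)}\,\frac{dx}{x^{\rho}}\right).$$ -/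

import Mathlib

noncomputable section

/-- The maximum modulus `M(r) = max {|f z| : |z| ≤ r}` of a function `f` on the complex plane
(for continuous `f` and `0 ≤ r` the supremum is a maximum). -/
def maxModulus (f : ℂ → ℂ) (r : ℝ) : ℝ :=
  sSup ((fun z : ℂ => ‖f z‖) '' Metric.closedBall (0 : ℂ) r)

/-- The order of growth of an entire function, as an extended real number:
`limsup_{r → ∞} log log M(r) / log r`. Positive parts `log⁺ = max 0 log` are used; they change
nothing for nonconstant entire functions (where `M(r) → ∞`) and give constants order `0`. -/
def growthOrder (f : ℂ → ℂ) : EReal :=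
  Filter.limsup
    (fun r : ℝ => ((Real.posLog (Real.posLog (maxModulus f r)) / Real.log r : ℝ) : EReal))
    Filter.atTop

end

/-! For a single factor `1 + z / a` everything is explicit: with `c = cos (arg z)`, `|1 + z/a| ≤ (1
+ c|z|/a) ^ (1/c)`, and `log (1 + x)` is at most a constant times `x ^ ρ`. The resulting bound is a
multiple of `a ^ (-ρ)`, which is the integral of `x ^ (-ρ) / (x + a)` up to Gamma factors
(`log_norm_one_add_div_le`). Since `1 / (x + a)` is the logarithmic derivative of the factor,
summing over zeros gives the upper bound for finite products.

No Hadamard factorisation is needed to reach `f`. Dividing out the zeros in a disc of radius `R`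
leaves a zero-free factor `f 0 * exp h`, and Borel–Carathéodory gives `h = O(R ^ (σ - 1))` on
compact sets for some `σ < 1`; hence `f / f 0` is a pointwise limit of the finite products
(`exists_seq_negRootPoly`). The quotient stays in the same class, so its logarithmic derivative is
nonnegative on the positive axis and the integral for each product is at most that for `f`
(`sum_inv_le_logDeriv`). -/

/-! ### The inequality for a single zero. -/

-- Insert `1 / (x + a) = ∫ exp (-(x + a) t) dt` and apply Tonelli; with lower integrals, finiteness
-- and value come together.
open MeasureTheory in
lemma integrableOn_and_integral_rpow_neg_div_add {ρ a : ℝ} (hρ : 0 < ρ) (hρ' : ρ < 1) (ha : 0 < a) :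
    IntegrableOn (fun x : ℝ => x ^ (-ρ) / (x + a)) (Set.Ioi 0) ∧
      ∫ x in Set.Ioi (0 : ℝ), x ^ (-ρ) / (x + a) =
        Real.Gamma (1 - ρ) * Real.Gamma ρ * (1 / a) ^ ρ := by
  have hexp : ∀ r : ℝ, 0 < r → ∫⁻ t in Set.Ioi (0 : ℝ), ENNReal.ofReal (Real.exp (-(r * t))) =
      ENNReal.ofReal (1 / r) := by
    intro r hr
    have h := Real.integral_rpow_mul_exp_neg_mul_Ioi (a := 1) one_pos hr
    have hi : IntegrableOn (fun t : ℝ => Real.exp (-(r * t))) (Set.Ioi 0) := by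
      simpa [neg_mul] using exp_neg_integrableOn_Ioi 0 hr
    rw [← ofReal_integral_eq_lintegral_ofReal hi (ae_of_all _ fun t => (Real.exp_pos _).le)]
    simp at h
    rw [h, one_div]
  have hgam : ∀ s r : ℝ, 0 < s → 0 < r →
      ∫⁻ t in Set.Ioi (0 : ℝ), ENNReal.ofReal (t ^ (s - 1) * Real.exp (-(r * t))) =
      ENNReal.ofReal ((1 / r) ^ s * Real.Gamma s) := by
    intro s r hs hr
    have h := Real.integral_rpow_mul_exp_neg_mul_Ioi hs hr
    have hpos : 0 < (1 / r) ^ s * Real.Gamma s :=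
      mul_pos (Real.rpow_pos_of_pos (by positivity) _) (Real.Gamma_pos_of_pos hs)
    have hi : IntegrableOn (fun t : ℝ => t ^ (s - 1) * Real.exp (-(r * t))) (Set.Ioi 0) := by
      -- The integral of a non-integrable function is `0` by convention, whereas this value is
      -- positive.
      by_contra hn
      rw [integral_undef hn] at h
      exact hpos.ne h
    rw [← ofReal_integral_eq_lintegral_ofReal hi, h]
    filter_upwards [ae_restrict_mem measurableSet_Ioi] with t ht
    have : (0 : ℝ) < t := ht
    positivity
  have key : ∫⁻ x in Set.Ioi (0 : ℝ), ENNReal.ofReal (x ^ (-ρ) / (x + a)) =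
      ENNReal.ofReal (Real.Gamma (1 - ρ) * Real.Gamma ρ * (1 / a) ^ ρ) := by
    calc ∫⁻ x in Set.Ioi (0 : ℝ), ENNReal.ofReal (x ^ (-ρ) / (x + a))
        = ∫⁻ x in Set.Ioi (0 : ℝ), ∫⁻ t in Set.Ioi (0 : ℝ),
            ENNReal.ofReal (x ^ (-ρ) * Real.exp (-((x + a) * t))) := by
          refine setLIntegral_congr_fun measurableSet_Ioi fun x hx => ?_
          have hx : (0 : ℝ) < x := hx
          have hxp : 0 ≤ x ^ (-ρ) := Real.rpow_nonneg hx.le _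
          simp only [ENNReal.ofReal_mul hxp]
          rw [lintegral_const_mul' _ _ ENNReal.ofReal_ne_top, hexp _ (by positivity),
            ← ENNReal.ofReal_mul hxp, mul_one_div]
      _ = ∫⁻ t in Set.Ioi (0 : ℝ), ∫⁻ x in Set.Ioi (0 : ℝ),
            ENNReal.ofReal (x ^ (-ρ) * Real.exp (-((x + a) * t))) := by
          refine lintegral_lintegral_swap (Measurable.aemeasurable ?_)
          unfold Function.uncurry
          fun_prop
      _ = ∫⁻ t in Set.Ioi (0 : ℝ),
            ENNReal.ofReal (Real.Gamma (1 - ρ)) *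
              ENNReal.ofReal (t ^ (ρ - 1) * Real.exp (-(a * t))) := by
          refine setLIntegral_congr_fun measurableSet_Ioi fun t ht => ?_
          have ht : (0 : ℝ) < t := ht
          have e1 : ∀ x : ℝ, x ^ (-ρ) * Real.exp (-((x + a) * t)) =
              Real.exp (-(a * t)) * (x ^ ((1 - ρ) - 1) * Real.exp (-(t * x))) := by
            intro x
            rw [show -((x + a) * t) = -(a * t) + -(t * x) by ring, Real.exp_add,
              show (1 - ρ) - 1 = -ρ by ring]
            ring
          simp only [e1, ENNReal.ofReal_mul (Real.exp_pos (-(a * t))).le]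
          rw [lintegral_const_mul' _ _ ENNReal.ofReal_ne_top, hgam _ _ (by linarith) ht,
            ← ENNReal.ofReal_mul (Real.exp_pos _).le,
            ← ENNReal.ofReal_mul (Real.Gamma_pos_of_pos (by linarith)).le,
            one_div, Real.inv_rpow ht.le, ← Real.rpow_neg ht.le,
            show -(1 - ρ) = ρ - 1 by ring]
          congr 1
          ring
      _ = _ := by
          rw [lintegral_const_mul' _ _ ENNReal.ofReal_ne_top, hgam _ _ hρ ha,
            ← ENNReal.ofReal_mul (Real.Gamma_pos_of_pos (by linarith)).le]
          congr 1
          ring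
  have hnn : 0 ≤ᵐ[volume.restrict (Set.Ioi (0 : ℝ))] fun x : ℝ => x ^ (-ρ) / (x + a) := by
    filter_upwards [ae_restrict_mem measurableSet_Ioi] with t ht
    have : (0 : ℝ) < t := ht
    simp only [Pi.zero_apply]
    positivity
  have hm : Measurable fun x : ℝ => x ^ (-ρ) / (x + a) := by fun_prop
  have h1 := Real.Gamma_pos_of_pos hρ
  have h2 : 0 < Real.Gamma (1 - ρ) := Real.Gamma_pos_of_pos (by linarith)
  refine ⟨⟨hm.aestronglyMeasurable, ?_⟩, ?_⟩
  · rw [hasFiniteIntegral_iff_ofReal hnn, key]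
    exact ENNReal.ofReal_lt_top
  · rw [integral_eq_lintegral_of_nonneg_ae hnn hm.aestronglyMeasurable, key,
      ENNReal.toReal_ofReal (by positivity)]

/-- The function `t ^ ρ * exp (-t)` is largest at `t = ρ`; this is the source of the constant `(ρ /
e) ^ ρ`. -/
lemma exp_neg_le_rpow {ρ t : ℝ} (hρ : 0 < ρ) (ht : 0 < t) :
    Real.exp (-t) ≤ (ρ / Real.exp 1) ^ ρ * t ^ (-ρ) := by
  have h := Real.add_one_le_exp (t / ρ - 1)
  have h1 : t / ρ ≤ Real.exp (t / ρ - 1) := by linarith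
  have h2 : (t / ρ) ^ ρ ≤ Real.exp (t - ρ) := by
    calc (t / ρ) ^ ρ ≤ Real.exp (t / ρ - 1) ^ ρ :=
          Real.rpow_le_rpow (by positivity) h1 hρ.le
      _ = _ := by
          rw [← Real.exp_mul]
          congr 1
          field_simp
  rw [Real.div_rpow hρ.le (Real.exp_pos 1).le, ← Real.exp_mul, one_mul, Real.rpow_neg ht.le]
  rw [Real.div_rpow ht.le hρ.le, Real.exp_sub, div_le_div_iff₀ (by positivity) (by positivity)] at h2
  rw [Real.exp_neg, ← div_eq_mul_inv, div_div, inv_eq_one_div,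
    div_le_div_iff₀ (by positivity) (by positivity)]
  linarith

-- Write `1 / (1 + x)` as the integral of `exp (-t) * exp (-x t)` and bound only the first
-- exponential by `exp_neg_le_rpow`; what remains is a Gamma integral.
open MeasureTheory in
lemma inv_one_add_le_rpow {ρ x : ℝ} (hρ : 0 < ρ) (hρ' : ρ < 1) (hx : 0 < x) :
    1 / (1 + x) ≤ (ρ / Real.exp 1) ^ ρ * Real.Gamma (1 - ρ) * x ^ (ρ - 1) := by
  have hG : 0 < Real.Gamma (1 - ρ) := Real.Gamma_pos_of_pos (by linarith)
  have h1 := Real.integral_rpow_mul_exp_neg_mul_Ioi (a := 1) one_pos (show 0 < 1 + x by linarith)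
  have h2 := Real.integral_rpow_mul_exp_neg_mul_Ioi (a := 1 - ρ) (by linarith) hx
  have hpos : 0 < (1 / x) ^ (1 - ρ) * Real.Gamma (1 - ρ) := by positivity
  have hi2 : IntegrableOn (fun t : ℝ => t ^ (1 - ρ - 1) * Real.exp (-(x * t))) (Set.Ioi 0) := by
    by_contra hn
    rw [integral_undef hn] at h2
    exact hpos.ne h2
  have hi1 : IntegrableOn (fun t : ℝ => Real.exp (-((1 + x) * t))) (Set.Ioi 0) := by
    have := exp_neg_integrableOn_Ioi 0 (show 0 < 1 + x by linarith)
    simpa only [neg_mul] using this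
  simp at h1
  rw [one_div, ← h1]
  calc _ ≤ ∫ t in Set.Ioi (0 : ℝ),
        (ρ / Real.exp 1) ^ ρ * (t ^ (1 - ρ - 1) * Real.exp (-(x * t))) := by
        refine setIntegral_mono_on hi1 (hi2.const_mul _) measurableSet_Ioi fun t ht => ?_
        rw [show -((1 + x) * t) = -t + -(x * t) by ring, Real.exp_add, ← mul_assoc,
          show 1 - ρ - 1 = -ρ by ring]
        gcongr
        exact exp_neg_le_rpow hρ ht
    _ = _ := by
        rw [integral_const_mul, h2, one_div, Real.inv_rpow hx.le, ← Real.rpow_neg hx.le,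
          neg_sub]
        ring

lemma log_one_add_le_rpow {ρ x : ℝ} (hρ : 0 < ρ) (hρ' : ρ < 1) (hx : 0 ≤ x) :
    Real.log (1 + x) ≤ (ρ / Real.exp 1) ^ ρ * (Real.Gamma (1 - ρ) / ρ) * x ^ ρ := by
  set C := (ρ / Real.exp 1) ^ ρ * (Real.Gamma (1 - ρ) / ρ)
  have hmono : MonotoneOn (fun y : ℝ => C * y ^ ρ - Real.log (1 + y)) (Set.Ici 0) := by
    refine monotoneOn_of_deriv_nonneg (convex_Ici 0) ?_ ?_ ?_
    · refine ContinuousOn.sub ?_ ?_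
      · exact (continuous_const.mul (Real.continuous_rpow_const hρ.le)).continuousOn
      · refine ContinuousOn.log (by fun_prop) fun y hy => ?_
        have : (0 : ℝ) ≤ y := hy
        positivity
    · intro y hy
      rw [interior_Ici] at hy
      have hy : (0 : ℝ) < y := hy
      have : (1 : ℝ) + y ≠ 0 := by positivity
      exact ((((Real.hasDerivAt_rpow_const (Or.inl hy.ne')).const_mul C).sub
        (((hasDerivAt_id y).const_add 1).log this)).differentiableAt).differentiableWithinAt
    · intro y hy
      rw [interior_Ici] at hy
      have hy : (0 : ℝ) < y := hy
      have h1 : (1 : ℝ) + y ≠ 0 := by positivity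
      have := (((Real.hasDerivAt_rpow_const (p := ρ) (Or.inl hy.ne')).const_mul C).sub
        (((hasDerivAt_id y).const_add 1).log h1)).deriv
      change 0 ≤ deriv ((fun y : ℝ => C * y ^ ρ) - fun y => Real.log (1 + id y)) y
      rw [this]
      have h := inv_one_add_le_rpow hρ hρ' hy
      have : C * (ρ * y ^ (ρ - 1)) =
          (ρ / Real.exp 1) ^ ρ * Real.Gamma (1 - ρ) * y ^ (ρ - 1) := by
        simp only [C]
        field_simp
      simp only [id]
      linarith
  have := hmono (Set.self_mem_Ici) hx hx
  simp [Real.zero_rpow hρ.ne'] at this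
  linarith

/-- With `c = cos θ` the left side is `log |1 + r exp (iθ)|²`, so a complex point is traded for its
real part `r c`. Both sides vanish at `r = 0` and their derivatives compare. -/
lemma log_one_add_two_mul_add_sq_le {c r : ℝ} (hc : 0 < c) (hc' : c ≤ 1) (hr : 0 ≤ r) :
    Real.log (1 + 2 * r * c + r ^ 2) ≤ 2 / c * Real.log (1 + r * c) := by
  have hd : ∀ y : ℝ, 0 ≤ y → HasDerivAt
      (fun y : ℝ => 2 / c * Real.log (1 + y * c) - Real.log (1 + 2 * y * c + y ^ 2))
      (2 / c * (c / (1 + y * c)) - (2 * c + 2 * y) / (1 + 2 * y * c + y ^ 2)) y := by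
    intro y hy
    have h1 : HasDerivAt (fun y : ℝ => 1 + y * c) c y := by
      simpa using ((hasDerivAt_id y).mul_const c).const_add 1
    have h2 : HasDerivAt (fun y : ℝ => 1 + 2 * y * c + y ^ 2) (2 * c + 2 * y) y := by
      have a1 : HasDerivAt (fun y : ℝ => 1 + 2 * y * c) (2 * c) y := by
        simpa using (((hasDerivAt_id y).const_mul 2).mul_const c).const_add 1
      have a2 : HasDerivAt (fun y : ℝ => y ^ 2) (2 * y) y := by simpa using hasDerivAt_pow 2 y
      exact a1.add a2
    exact ((h1.log (by positivity)).const_mul _).sub (h2.log (by positivity))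
  have hmono : MonotoneOn
      (fun y : ℝ => 2 / c * Real.log (1 + y * c) - Real.log (1 + 2 * y * c + y ^ 2))
      (Set.Ici 0) := by
    refine monotoneOn_of_deriv_nonneg (convex_Ici 0)
      (fun y hy => (hd y hy).continuousAt.continuousWithinAt) ?_ ?_
    · intro y hy
      rw [interior_Ici] at hy
      exact (hd y (le_of_lt hy)).differentiableAt.differentiableWithinAt
    · intro y hy
      rw [interior_Ici] at hy
      have hy : (0 : ℝ) < y := hy
      rw [(hd y hy.le).deriv, show 2 / c * (c / (1 + y * c)) = 2 / (1 + y * c) by field_simp,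
        sub_nonneg, div_le_div_iff₀ (by positivity) (by positivity)]
      -- After cross-multiplication the difference is `2 (1 - c) ((y - 1)² + c y + y)`.
      nlinarith [mul_nonneg (sub_nonneg.2 hc') (sq_nonneg (y - 1)),
        mul_nonneg (mul_nonneg (sub_nonneg.2 hc') hc.le) hy.le,
        mul_nonneg (sub_nonneg.2 hc') hy.le]
  have := hmono (Set.self_mem_Ici) hr hr
  simp at this
  linarith

open MeasureTheory in
lemma log_norm_one_add_div_le {ρ a : ℝ} (hρ : 0 < ρ) (hρ' : ρ < 1) (ha : 0 < a) {z : ℂ}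
    (hz : |z.arg| < Real.pi / 2) :
    Real.log ‖1 + z / a‖ ≤ (ρ / Real.exp 1) ^ ρ * ‖z‖ ^ ρ
            / (Real.cos (Complex.arg z) ^ (1 - ρ) * Real.Gamma (1 + ρ)) *
        ∫ x in Set.Ioi (0 : ℝ), x ^ (-ρ) / (x + a) := by
  rw [(integrableOn_and_integral_rpow_neg_div_add hρ hρ' ha).2]
  have hc : 0 < Real.cos z.arg := Real.cos_pos_of_mem_Ioo (abs_lt.1 hz)
  have hre := Complex.norm_mul_cos_arg z
  set c := Real.cos z.arg
  have hsq : ‖1 + z / a‖ ^ 2 = 1 + 2 * (‖z‖ / a) * c + (‖z‖ / a) ^ 2 := by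
    have e : (1 : ℂ) + z / a = 1 + ((1 / a : ℝ) : ℂ) * z := by
      push_cast
      ring
    have e2 : ‖z‖ ^ 2 = z.re ^ 2 + z.im ^ 2 := by
      rw [Complex.sq_norm, Complex.normSq_apply]; ring
    rw [show 2 * (‖z‖ / a) * c = 2 * (‖z‖ * c) / a by ring, hre, div_pow, e2, e,
      Complex.sq_norm, Complex.normSq_apply]
    simp
    field_simp
    ring
  have h1 := log_one_add_two_mul_add_sq_le hc (Real.cos_le_one _)
    (show 0 ≤ ‖z‖ / a by positivity)
  have h2 := log_one_add_le_rpow hρ hρ' (show 0 ≤ ‖z‖ / a * c by positivity)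
  rw [← hsq, Real.log_pow] at h1
  push_cast at h1
  have h3 : Real.log ‖1 + z / a‖ ≤ 1 / c * Real.log (1 + ‖z‖ / a * c) := by
    have : 2 / c * Real.log (1 + ‖z‖ / a * c) = 2 * (1 / c * Real.log (1 + ‖z‖ / a * c)) := by
      ring
    linarith
  refine h3.trans ((mul_le_mul_of_nonneg_left h2 (by positivity)).trans (le_of_eq ?_))
  have hG : 0 < Real.Gamma ρ := Real.Gamma_pos_of_pos hρ
  rw [show 1 + ρ = ρ + 1 by ring, Real.Gamma_add_one hρ.ne', Real.mul_rpow (by positivity) hc.le,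
    div_eq_mul_one_div ‖z‖ a, Real.mul_rpow (by positivity) (by positivity), Real.rpow_sub hc,
    Real.rpow_one]
  have : c ^ ρ ≠ 0 := by positivity
  field_simp

/-! ### Finite products with negative zeros. -/

/-- The polynomial `∏ (1 + z / a)` with zeros at the points `-a`, normalised at the origin. -/
noncomputable def negRootPoly (s : Multiset ℝ) (z : ℂ) : ℂ :=
  (s.map fun a : ℝ => 1 + z / a).prod

/-- Entire functions whose zeros are negative reals, with growth at most `exp (r ^ σ)`. -/
structure NegZerosOfGrowth (σ : ℝ) (f : ℂ → ℂ) : Prop where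
  differentiable : Differentiable ℂ f
  zeros : ∀ w : ℂ, f w = 0 → ∃ x : ℝ, x < 0 ∧ w = (x : ℂ)
  growth : ∀ᶠ r : ℝ in Filter.atTop, ∀ z : ℂ, ‖z‖ = r → ‖f z‖ ≤ Real.exp (r ^ σ)

@[simp] lemma negRootPoly_zero (z : ℂ) : negRootPoly 0 z = 1 := by simp [negRootPoly]

@[simp] lemma negRootPoly_cons (a : ℝ) (s : Multiset ℝ) (z : ℂ) :
    negRootPoly (a ::ₘ s) z = (1 + z / a) * negRootPoly s z := by simp [negRootPoly]

lemma negRootPoly_apply_zero (s : Multiset ℝ) : negRootPoly s 0 = 1 := by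
  induction s using Multiset.induction with
  | empty => simp
  | cons a s ih => simp [ih]

lemma differentiable_negRootPoly (s : Multiset ℝ) : Differentiable ℂ (negRootPoly s) := by
  induction s using Multiset.induction with
  | empty =>
    have : negRootPoly 0 = fun _ => 1 := funext negRootPoly_zero
    rw [this]
    fun_prop
  | cons a s ih =>
    have : negRootPoly (a ::ₘ s) = fun z => (1 + z / a) * negRootPoly s z :=
      funext (negRootPoly_cons a s)
    rw [this]
    fun_prop

/-- Each factor satisfies `|1 + z/a| ≥ |z|/a - 1 ≥ c`. The case `c = 3` bounds the number of zeros
in a disc; the case `c = 1` shows that division by the product does not worsen growth. -/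
lemma pow_card_le_norm_negRootPoly {s : Multiset ℝ} {R c : ℝ} (hc : 0 ≤ c)
    (hs : ∀ a ∈ s, 0 < a ∧ a ≤ R) {z : ℂ} (hz : (c + 1) * R ≤ ‖z‖) :
    c ^ s.card ≤ ‖negRootPoly s z‖ := by
  induction s using Multiset.induction with
  | empty => simp
  | cons a s ih =>
    obtain ⟨ha, haR⟩ := hs a (Multiset.mem_cons_self a s)
    rw [negRootPoly_cons, norm_mul, Multiset.card_cons, pow_succ']
    refine mul_le_mul ?_ (ih fun b hb => hs b (Multiset.mem_cons_of_mem hb)) (by positivity)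
      (norm_nonneg _)
    have h1 : c + 1 ≤ ‖z / a‖ := by
      rw [norm_div, Complex.norm_real, Real.norm_of_nonneg ha.le, le_div_iff₀ ha]
      exact (mul_le_mul_of_nonneg_left haR (by linarith)).trans hz
    have h2 := norm_sub_le_norm_add (z / a) 1
    rw [norm_one, add_comm (z / (a : ℂ))] at h2
    linarith

lemma norm_one_add_div_mono {a : ℝ} (ha : 0 < a) {z : ℂ} (hz : 0 ≤ z.re) :
    1 ≤ ‖1 + (z.re : ℂ) / a‖ ∧ ‖1 + (z.re : ℂ) / a‖ ≤ ‖1 + z / a‖ := by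
  have e : (1 : ℂ) + (z.re : ℂ) / a = ((1 + z.re / a : ℝ) : ℂ) := by push_cast; rfl
  have h0 : 0 ≤ z.re / a := by positivity
  rw [e, Complex.norm_real, Real.norm_of_nonneg (by linarith)]
  refine ⟨by linarith, ?_⟩
  have := Complex.re_le_norm (1 + z / a)
  simpa [Complex.div_ofReal_re] using this

lemma norm_negRootPoly_mono {s : Multiset ℝ} (hs : ∀ a ∈ s, 0 < a) {z : ℂ} (hz : 0 ≤ z.re) :
    1 ≤ ‖negRootPoly s (z.re : ℂ)‖ ∧ ‖negRootPoly s (z.re : ℂ)‖ ≤ ‖negRootPoly s z‖ := by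
  induction s using Multiset.induction with
  | empty => simp
  | cons a s ih =>
    obtain ⟨h1, h2⟩ := ih fun b hb => hs b (Multiset.mem_cons_of_mem hb)
    obtain ⟨h3, h4⟩ := norm_one_add_div_mono (hs a (Multiset.mem_cons_self a s)) hz
    simp only [negRootPoly_cons, norm_mul]
    exact ⟨one_le_mul_of_one_le_of_one_le h3 h1,
      mul_le_mul h4 h2 (norm_nonneg _) (norm_nonneg _)⟩

lemma logDeriv_negRootPoly {s : Multiset ℝ} (hs : ∀ a ∈ s, 0 < a) {x : ℝ} (hx : 0 ≤ x) :
    logDeriv (negRootPoly s) (x : ℂ) = ((s.map fun a => 1 / (x + a)).sum : ℝ) := by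
  induction s using Multiset.induction with
  | empty =>
    have : negRootPoly 0 = fun _ => 1 := funext negRootPoly_zero
    simp [this]
  | cons a s ih =>
    have hs' : ∀ b ∈ s, 0 < b := fun b hb => hs b (Multiset.mem_cons_of_mem hb)
    have ha := hs a (Multiset.mem_cons_self a s)
    have e : negRootPoly (a ::ₘ s) = fun z => (1 + z / a) * negRootPoly s z :=
      funext (negRootPoly_cons a s)
    have h1 := (norm_one_add_div_mono ha (z := (x : ℂ)) (by simpa using hx)).1
    have h2 := (norm_negRootPoly_mono hs' (z := (x : ℂ)) (by simpa using hx)).1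
    rw [Complex.ofReal_re] at h1 h2
    rw [e, logDeriv_mul (f := fun z : ℂ => 1 + z / a) (g := negRootPoly s) (x : ℂ)
      (norm_pos_iff.1 (by linarith)) (norm_pos_iff.1 (by linarith)) (by fun_prop)
      (differentiable_negRootPoly s _), ih hs', Multiset.map_cons, Multiset.sum_cons,
      Complex.ofReal_add]
    congr 1
    have hd : deriv (fun z : ℂ => 1 + z / a) x = 1 / a := by simp
    rw [logDeriv_apply, hd]
    have ha' : (a : ℂ) ≠ 0 := by exact_mod_cast ha.ne'
    have hxa : (x : ℂ) + a ≠ 0 := by exact_mod_cast (by positivity : x + a ≠ 0)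
    have hxa' : (a : ℂ) + x ≠ 0 := by rwa [add_comm]
    push_cast
    field_simp
    ring

/-- Termwise this is `y / (1 + y) ≤ log (1 + y)` at `y = x / a`. In the limit it controls the decay
of `f' / f` by the growth of `f`. -/
lemma mul_sum_inv_le_log_norm_negRootPoly {s : Multiset ℝ} (hs : ∀ a ∈ s, 0 < a) {x : ℝ}
    (hx : 0 ≤ x) :
    x * (s.map fun a => 1 / (x + a)).sum ≤ Real.log ‖negRootPoly s (x : ℂ)‖ := by
  induction s using Multiset.induction with
  | empty => simp
  | cons a s ih =>
    have hs' : ∀ b ∈ s, 0 < b := fun b hb => hs b (Multiset.mem_cons_of_mem hb)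
    have ha := hs a (Multiset.mem_cons_self a s)
    have h1 := (norm_one_add_div_mono ha (z := (x : ℂ)) (by simpa using hx)).1
    have h2 := (norm_negRootPoly_mono hs' (z := (x : ℂ)) (by simpa using hx)).1
    rw [Complex.ofReal_re] at h1 h2
    have e : (1 : ℂ) + (x : ℂ) / a = ((1 + x / a : ℝ) : ℂ) := by push_cast; rfl
    have h0 : 0 ≤ x / a := by positivity
    rw [negRootPoly_cons, norm_mul, Real.log_mul (by linarith) (by linarith), Multiset.map_cons,
      Multiset.sum_cons, mul_add]
    refine add_le_add ?_ (ih hs')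
    rw [e, Complex.norm_real, Real.norm_of_nonneg (by linarith)]
    have h3 := Real.one_sub_inv_le_log_of_pos (show 0 < 1 + x / a by linarith)
    have : 1 - (1 + x / a)⁻¹ = x * (1 / (x + a)) := by field_simp; ring
    linarith

/-! ### Dividing out zeros and taking logarithms. -/

/-- An entire function with a zero at `-a` is divisible by `1 + z / a`. -/
lemma exists_eq_one_add_div_mul {g : ℂ → ℂ} (hg : Differentiable ℂ g) {a : ℝ} (ha : 0 < a)
    (h0 : g ((-a : ℝ) : ℂ) = 0) :
    ∃ k : ℂ → ℂ, Differentiable ℂ k ∧ ∀ z, g z = (1 + z / a) * k z := by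
  refine ⟨fun z => a * dslope g ((-a : ℝ) : ℂ) z, ?_, fun z => ?_⟩
  · refine Differentiable.const_mul ?_ _
    rw [← differentiableOn_univ, Complex.differentiableOn_dslope Filter.univ_mem]
    exact hg.differentiableOn
  · have h := sub_smul_dslope g ((-a : ℝ) : ℂ) z
    rw [h0, sub_zero, smul_eq_mul] at h
    have ha' : (a : ℂ) ≠ 0 := by exact_mod_cast ha.ne'
    rw [← h]
    push_cast
    field_simp
    ring

/-- Division by the zeros in a disc leaves an entire function that is zero-free there. -/
lemma exists_eq_negRootPoly_mul {f : ℂ → ℂ} (hf : Differentiable ℂ f)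
    (hz : ∀ w : ℂ, f w = 0 → ∃ x : ℝ, x < 0 ∧ w = (x : ℂ)) {R : ℝ} (hR : 0 < R) :
    ∃ (s : Multiset ℝ) (g : ℂ → ℂ), (∀ a ∈ s, 0 < a ∧ a ≤ R) ∧ Differentiable ℂ g ∧
      (∀ z, f z = negRootPoly s z * g z) ∧ ∀ z, ‖z‖ ≤ R → g z ≠ 0 := by
  -- If division never stopped, `f` would be divisible by products with any number `k` of factors.
  by_contra! H
  have hall : ∀ k : ℕ, ∃ (s : Multiset ℝ) (g : ℂ → ℂ), s.card = k ∧ (∀ a ∈ s, 0 < a ∧ a ≤ R) ∧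
      Differentiable ℂ g ∧ ∀ z, f z = negRootPoly s z * g z := by
    intro k
    induction k with
    | zero => exact ⟨0, f, by simp, by simp, hf, by simp⟩
    | succ k ih =>
      obtain ⟨s, g, hk, hs, hg, hfg⟩ := ih
      obtain ⟨w, hwR, hw⟩ := H s g hs hg hfg
      obtain ⟨x, hx, rfl⟩ := hz w (by rw [hfg, hw, mul_zero])
      rw [Complex.norm_real, Real.norm_of_nonpos hx.le] at hwR
      obtain ⟨k', hk', hgk⟩ := exists_eq_one_add_div_mul hg (a := -x) (by linarith)
        (by simpa using hw)
      refine ⟨-x ::ₘ s, k', by simp [hk], ?_, hk', fun z => ?_⟩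
      · intro b hb
        rcases Multiset.mem_cons.1 hb with rfl | hb
        · exact ⟨by linarith, hwR⟩
        · exact hs b hb
      · rw [hfg, hgk, negRootPoly_cons]
        ring
  have hf0 : f 0 ≠ 0 := fun h => by
    obtain ⟨x, hx, h⟩ := hz 0 h
    exact hx.ne' (by exact_mod_cast h)
  obtain ⟨B, hB⟩ := (isCompact_sphere (0 : ℂ) (4 * R)).exists_bound_of_continuousOn
    hf.continuous.continuousOn
  obtain ⟨k, hk⟩ := pow_unbounded_of_one_lt (B / ‖f 0‖) (show (1 : ℝ) < 3 by norm_num)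
  obtain ⟨s, g, hsk, hs, hg, hfg⟩ := hall k
  -- On `|z| = 4R` every factor has modulus at least `3`, so the maximum principle yields `|f 0| ≤ B
  -- / 3 ^ k`, impossible for large `k`.
  have hgb : ∀ z ∈ frontier (Metric.ball (0 : ℂ) (4 * R)), ‖g z‖ ≤ B / 3 ^ k := by
    intro z hz
    rw [frontier_ball _ (by positivity)] at hz
    have h1 := hB z hz
    have h2 := pow_card_le_norm_negRootPoly (c := 3) (by norm_num) hs (z := z)
      (by rw [mem_sphere_zero_iff_norm.1 hz]; linarith)
    rw [hfg, norm_mul] at h1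
    rw [hsk] at h2
    rw [le_div_iff₀ (by positivity), mul_comm]
    exact (mul_le_mul_of_nonneg_right h2 (norm_nonneg _)).trans h1
  have h0 := Complex.norm_le_of_forall_mem_frontier_norm_le Metric.isBounded_ball
    hg.diffContOnCl hgb (z := 0) (subset_closure (Metric.mem_ball_self (by positivity)))
  have : f 0 = g 0 := by rw [hfg, negRootPoly_apply_zero, one_mul]
  rw [← this, le_div_iff₀ (by positivity), mul_comm, ← le_div_iff₀ (norm_pos_iff.2 hf0)] at h0
  linarith

/-- A zero-free function on a disc that is not much larger than its central value is
the exponential of a small function. -/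
lemma exists_eq_mul_exp_of_norm_le {g : ℂ → ℂ} {R M : ℝ} (hR : 0 < R) (hM : 0 < M)
    (hg : Differentiable ℂ g) (h0 : ∀ z ∈ Metric.ball (0 : ℂ) R, g z ≠ 0)
    (hb : ∀ z ∈ Metric.ball (0 : ℂ) R, ‖g z‖ ≤ ‖g 0‖ * Real.exp M) :
    ∃ h : ℂ → ℂ, DifferentiableOn ℂ h (Metric.ball 0 R) ∧
      (∀ z ∈ Metric.ball (0 : ℂ) R, g z = g 0 * Complex.exp (h z)) ∧
      ∀ z ∈ Metric.ball (0 : ℂ) R, ‖h z‖ ≤ 2 * M * ‖z‖ / (R - ‖z‖) := by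
  have hmem : (0 : ℂ) ∈ Metric.ball (0 : ℂ) R := Metric.mem_ball_self hR
  have hdg : Differentiable ℂ (deriv g) := by
    rw [← differentiableOn_univ]
    exact hg.differentiableOn.deriv isOpen_univ
  have hd : DifferentiableOn ℂ (fun z => deriv g z / g z) (Metric.ball 0 R) :=
    hdg.differentiableOn.div hg.differentiableOn h0
  obtain ⟨h, hh0, hh⟩ := hd.isExactOn_ball.with_val_at 0 0
  have hhd : DifferentiableOn ℂ h (Metric.ball 0 R) :=
    fun z hz => (hh z hz).differentiableAt.differentiableWithinAt
  have heq : ∀ z ∈ Metric.ball (0 : ℂ) R, g z = g 0 * Complex.exp (h z) := by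
    have hder : ∀ z ∈ Metric.ball (0 : ℂ) R,
        HasDerivAt (fun z => g z * Complex.exp (-h z)) 0 z := by
      intro z hz
      have := (hg z).hasDerivAt.mul (hh z hz).neg.cexp
      convert! this using 1
      field_simp [h0 z hz]
      ring
    intro z hz
    have hc := Metric.isOpen_ball.is_const_of_deriv_eq_zero (convex_ball (0 : ℂ) R).isPreconnected
      (fun z hz => (hder z hz).differentiableAt.differentiableWithinAt)
      (fun z hz => (hder z hz).deriv) hz hmem
    simp only [hh0, neg_zero, Complex.exp_zero, mul_one] at hc
    rw [← hc, mul_assoc, ← Complex.exp_add]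
    simp
  refine ⟨h, hhd, heq, fun z hz => ?_⟩
  refine Complex.borelCaratheodory_zero hM hhd (fun w hw => ?_) hR hz hh0
  -- As `|g w| = |g 0| * exp (Re h w)`, the bound on `g` says precisely `Re h ≤ M`.
  have h1 := hb w hw
  rw [heq w hw, norm_mul, Complex.norm_exp] at h1
  exact Real.exp_le_exp.1 (le_of_mul_le_mul_left h1 (norm_pos_iff.2 (h0 0 hmem)))

/-! ### From the order to a pointwise growth bound. -/

lemma Real.le_exp_posLog (x : ℝ) : x ≤ Real.exp (Real.posLog x) := by
  rcases le_or_gt x 0 with h | h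
  · exact h.trans (Real.exp_pos _).le
  · calc x = Real.exp (Real.log x) := (Real.exp_log h).symm
      _ ≤ _ := Real.exp_le_exp.2 (le_max_right _ _)

lemma norm_le_maxModulus {f : ℂ → ℂ} (hf : Continuous f) (z : ℂ) :
    ‖f z‖ ≤ maxModulus f ‖z‖ := by
  refine le_csSup ?_ ⟨z, by simp, rfl⟩
  exact ((isCompact_closedBall (0 : ℂ) ‖z‖).image hf.norm).bddAbove

lemma eventually_norm_le_of_growthOrder_lt {f : ℂ → ℂ} (hf : Continuous f) {σ : ℝ}
    (h : growthOrder f < (σ : EReal)) :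
    ∀ᶠ r : ℝ in Filter.atTop, ∀ z : ℂ, ‖z‖ = r → ‖f z‖ ≤ Real.exp (r ^ σ) := by
  filter_upwards [Filter.eventually_lt_of_limsup_lt h, Filter.eventually_gt_atTop 1]
    with r hr hr1 z hz
  rw [EReal.coe_lt_coe_iff, div_lt_iff₀ (Real.log_pos hr1)] at hr
  refine (norm_le_maxModulus hf z).trans ((Real.le_exp_posLog _).trans (Real.exp_le_exp.2 ?_))
  rw [hz]
  refine (Real.le_exp_posLog _).trans ?_
  rw [Real.rpow_def_of_pos (by linarith), mul_comm]
  exact Real.exp_le_exp.2 hr.le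

/-! ### Approximation by finite products and the logarithmic derivative. -/

namespace NegZerosOfGrowth

variable {σ : ℝ} {f : ℂ → ℂ}

lemma ne_zero_of_re_nonneg (hf : NegZerosOfGrowth σ f) {z : ℂ} (hz : 0 ≤ z.re) : f z ≠ 0 := by
  intro h
  obtain ⟨x, hx, rfl⟩ := hf.zeros z h
  simp at hz
  linarith

lemma of_eq_negRootPoly_mul (hf : NegZerosOfGrowth σ f) {s : Multiset ℝ} {R : ℝ}
    (hs : ∀ a ∈ s, 0 < a ∧ a ≤ R) {g : ℂ → ℂ} (hg : Differentiable ℂ g)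
    (hfg : ∀ z, f z = negRootPoly s z * g z) : NegZerosOfGrowth σ g where
  differentiable := hg
  zeros w hw := hf.zeros w (by rw [hfg, hw, mul_zero])
  growth := by
    filter_upwards [hf.growth, Filter.eventually_ge_atTop (2 * R)] with r hr hrR z hz
    have h1 := hr z hz
    have h2 := pow_card_le_norm_negRootPoly (c := 1) zero_le_one hs (z := z)
      (by rw [hz]; linarith)
    rw [one_pow] at h2
    rw [hfg, norm_mul] at h1
    exact (le_mul_of_one_le_left (norm_nonneg _) h2).trans h1

/-- Factorisation in a large disc, with explicit control of the zero-free factor. -/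
lemma eventually_exists_factorization (hf : NegZerosOfGrowth σ f) :
    ∀ᶠ R : ℝ in Filter.atTop, ∃ (s : Multiset ℝ) (g h : ℂ → ℂ), (∀ a ∈ s, 0 < a) ∧
      NegZerosOfGrowth σ g ∧ (∀ z, f z = negRootPoly s z * g z) ∧
      DifferentiableOn ℂ h (Metric.ball 0 R) ∧
      (∀ z ∈ Metric.ball (0 : ℂ) R, g z = f 0 * Complex.exp (h z)) ∧
      ∀ z ∈ Metric.ball (0 : ℂ) R,
        ‖h z‖ ≤ 2 * ((2 * R) ^ σ + (|Real.log ‖f 0‖| + 1)) * ‖z‖ / (R - ‖z‖) := by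
  have hgr := (Filter.tendsto_id.const_mul_atTop (show (0 : ℝ) < 2 by norm_num)).eventually
    hf.growth
  filter_upwards [hgr, Filter.eventually_gt_atTop 0] with R hR2 hR
  obtain ⟨s, g, hs, hg, hfg, hg0⟩ := exists_eq_negRootPoly_mul hf.differentiable hf.zeros hR
  have hfg0 : g 0 = f 0 := by rw [hfg 0, negRootPoly_apply_zero, one_mul]
  have hf0 : 0 < ‖f 0‖ := norm_pos_iff.2 (hf.ne_zero_of_re_nonneg (by simp))
  -- On `|z| = 2R` the product has modulus at least `1`, so `g` inherits the bound of `f` there, and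
  -- in the disc by the maximum principle.
  have hfr : ∀ z ∈ frontier (Metric.ball (0 : ℂ) (2 * R)), ‖g z‖ ≤ Real.exp ((2 * R) ^ σ) := by
    intro z hz
    rw [frontier_ball _ (by positivity), mem_sphere_zero_iff_norm] at hz
    have h1 := hR2 z hz
    have h2 := pow_card_le_norm_negRootPoly (c := 1) zero_le_one hs (z := z)
      (by rw [hz]; linarith)
    rw [one_pow] at h2
    rw [hfg, norm_mul] at h1
    exact (le_mul_of_one_le_left (norm_nonneg _) h2).trans h1
  have hbound : ∀ z ∈ Metric.ball (0 : ℂ) R,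
      -- The term `|log |f 0||` pays for measuring `g` relative to `g 0 = f 0`.
      ‖g z‖ ≤ ‖g 0‖ * Real.exp ((2 * R) ^ σ + (|Real.log ‖f 0‖| + 1)) := by
    intro z hz
    have h1 := Complex.norm_le_of_forall_mem_frontier_norm_le Metric.isBounded_ball
      hg.diffContOnCl hfr (z := z)
      (subset_closure (Metric.ball_subset_ball (by linarith) hz))
    refine h1.trans ?_
    rw [hfg0]
    nth_rw 1 [← Real.exp_log hf0]
    rw [← Real.exp_add]
    exact Real.exp_le_exp.2 (by linarith [neg_abs_le (Real.log ‖f 0‖)])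
  obtain ⟨h, hd, he, hb⟩ := exists_eq_mul_exp_of_norm_le hR
    (show 0 < (2 * R) ^ σ + (|Real.log ‖f 0‖| + 1) by positivity) hg
    (fun z hz => hg0 z (mem_ball_zero_iff.1 hz).le) hbound
  rw [hfg0] at he
  exact ⟨s, g, h, fun a ha => (hs a ha).1, hf.of_eq_negRootPoly_mul hs hg hfg, hfg, hd, he, hb⟩

/-- Here growth below order one is decisive: `R ^ σ / R → 0` makes the exponential factor disappear.
-/
lemma tendsto_borelCaratheodory_bound (hσ : σ < 1) (c K : ℝ) :
    Filter.Tendsto (fun R : ℝ => 2 * ((2 * R) ^ σ + c) * K / (R - K)) Filter.atTop (nhds 0) := by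
  have h1 : Filter.Tendsto (fun R : ℝ => R ^ (-(1 - σ))) Filter.atTop (nhds 0) :=
    tendsto_rpow_neg_atTop (by linarith)
  have h2 : Filter.Tendsto (fun R : ℝ => R⁻¹) Filter.atTop (nhds 0) := tendsto_inv_atTop_zero
  have h3 : Filter.Tendsto (fun R : ℝ => (R - K)⁻¹) Filter.atTop (nhds 0) :=
    tendsto_inv_atTop_zero.comp (Filter.tendsto_atTop_add_const_right _ (-K) Filter.tendsto_id)
  have h := (((h1.const_mul ((2 : ℝ) ^ σ)).add (h2.const_mul c)).const_mul (2 * K)).mul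
    ((h3.const_mul K).const_add 1)
  simp only [mul_zero, add_zero, zero_mul] at h
  refine h.congr' ?_
  filter_upwards [Filter.eventually_gt_atTop 0, Filter.eventually_gt_atTop K] with R hR hRK
  have hRK' : R - K ≠ 0 := by linarith
  rw [Real.mul_rpow (by norm_num) hR.le, show -(1 - σ) = σ - 1 by ring, Real.rpow_sub hR,
    Real.rpow_one]
  field_simp
  ring

/-- A function of growth less than `exp r` with negative zeros is, up to normalisation, a limit of
polynomials with negative zeros that divide it. -/
lemma exists_seq_negRootPoly (hf : NegZerosOfGrowth σ f) (hσ : σ < 1) :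
    ∃ s : ℕ → Multiset ℝ, (∀ n, ∀ a ∈ s n, 0 < a) ∧
      (∀ n, ∃ g, NegZerosOfGrowth σ g ∧ ∀ z, f z = negRootPoly (s n) z * g z) ∧
      (∀ z, Filter.Tendsto (fun n => negRootPoly (s n) z) Filter.atTop (nhds (f z / f 0))) ∧
      ∀ z : ℂ, 0 ≤ z.re → Filter.Tendsto (fun n => logDeriv (negRootPoly (s n)) z) Filter.atTop
        (nhds (logDeriv f z)) := by
  obtain ⟨R₀, hR₀⟩ := Filter.eventually_atTop.1 hf.eventually_exists_factorization
  choose s g h hs hg hfg hd he hb using fun n : ℕ =>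
    hR₀ (R₀ + n) (le_add_of_nonneg_right n.cast_nonneg)
  have hR : Filter.Tendsto (fun n : ℕ => R₀ + (n : ℝ)) Filter.atTop Filter.atTop :=
    Filter.tendsto_atTop_add_const_left _ _ tendsto_natCast_atTop_atTop
  have hf0 : f 0 ≠ 0 := hf.ne_zero_of_re_nonneg (by simp)
  have hbK : ∀ K : ℝ, ∀ n : ℕ, K < R₀ + n → ∀ z : ℂ, ‖z‖ ≤ K → ‖h n z‖ ≤
      2 * ((2 * (R₀ + n)) ^ σ + (|Real.log ‖f 0‖| + 1)) * K / (R₀ + n - K) := by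
    intro K n hK z hz
    have hpos : 0 ≤ R₀ + n := (norm_nonneg z).trans (hz.trans hK.le)
    have h1 := hb n z (mem_ball_zero_iff.2 (hz.trans_lt hK))
    refine h1.trans ?_
    have hKn : 0 < R₀ + n - K := by linarith
    have hK0 : 0 ≤ K := (norm_nonneg z).trans hz
    gcongr
  have hlim : ∀ z, Filter.Tendsto (fun n => h n z) Filter.atTop (nhds 0) := by
    intro z
    refine squeeze_zero_norm' ?_ ((tendsto_borelCaratheodory_bound hσ
      (|Real.log ‖f 0‖| + 1) ‖z‖).comp hR)
    filter_upwards [hR.eventually_gt_atTop ‖z‖] with n hn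
    exact hbK _ n hn z le_rfl
  -- Cauchy's estimate on a unit disc transfers the decay of `h` to its derivative.
  have hlim' : ∀ z, Filter.Tendsto (fun n => deriv (h n) z) Filter.atTop (nhds 0) := by
    intro z
    refine squeeze_zero_norm' ?_ ((tendsto_borelCaratheodory_bound hσ
      (|Real.log ‖f 0‖| + 1) (‖z‖ + 1)).comp hR)
    filter_upwards [hR.eventually_gt_atTop (‖z‖ + 1)] with n hn
    have hK : ∀ w ∈ Metric.closedBall z 1, ‖w‖ ≤ ‖z‖ + 1 := fun w hw => by
      have := norm_le_norm_add_norm_sub' w z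
      have h2 := mem_closedBall_iff_norm.1 hw
      linarith
    have hsub : Metric.closedBall z 1 ⊆ Metric.ball (0 : ℂ) (R₀ + n) := fun w hw =>
      mem_ball_zero_iff.2 ((hK w hw).trans_lt hn)
    have := Complex.norm_deriv_le_of_forall_mem_sphere_norm_le one_pos
      ((hd n).diffContOnCl_ball hsub)
      fun w hw => hbK _ n hn w (hK w (Metric.sphere_subset_closedBall hw))
    rwa [div_one] at this
  refine ⟨s, hs, fun n => ⟨g n, hg n, hfg n⟩, fun z => ?_, fun z hz => ?_⟩
  · have h1 : Filter.Tendsto (fun n => f z / f 0 * Complex.exp (-h n z)) Filter.atTop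
        (nhds (f z / f 0 * Complex.exp (-0))) :=
      ((Complex.continuous_exp.tendsto _).comp (hlim z).neg).const_mul _
    rw [neg_zero, Complex.exp_zero, mul_one] at h1
    refine h1.congr' ?_
    filter_upwards [hR.eventually_gt_atTop ‖z‖] with n hn
    rw [hfg n z, he n z (mem_ball_zero_iff.2 hn), Complex.exp_neg]
    have := Complex.exp_ne_zero (h n z)
    field_simp
  · have h1 := (hlim' z).const_sub (logDeriv f z)
    rw [sub_zero] at h1
    refine h1.congr' ?_
    filter_upwards [hR.eventually_gt_atTop ‖z‖] with n hn
    have hmem : z ∈ Metric.ball (0 : ℂ) (R₀ + n) := mem_ball_zero_iff.2 hn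
    have hfz := hf.ne_zero_of_re_nonneg hz
    have hPz : negRootPoly (s n) z ≠ 0 := fun h0 => hfz (by rw [hfg n, h0, zero_mul])
    have e1 : logDeriv f z = logDeriv (negRootPoly (s n)) z + logDeriv (g n) z := by
      rw [show f = fun z => negRootPoly (s n) z * g n z from funext (hfg n)]
      exact logDeriv_mul z hPz ((hg n).ne_zero_of_re_nonneg hz)
        (differentiable_negRootPoly _ z) ((hg n).differentiable z)
    have e2 : logDeriv (g n) z = deriv (h n) z := by
      have hev : g n =ᶠ[nhds z] fun z => f 0 * Complex.exp (h n z) :=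
        Filter.eventuallyEq_of_mem (Metric.isOpen_ball.mem_nhds hmem) (he n)
      have hda := (hd n).differentiableAt (Metric.isOpen_ball.mem_nhds hmem)
      rw [logDeriv_apply, hev.deriv_eq, he n z hmem,
        (hda.hasDerivAt.cexp.const_mul (f 0)).deriv]
      have := Complex.exp_ne_zero (h n z)
      field_simp
    rw [e1, e2]
    ring

/-- All three properties hold for finite products, by the explicit sum over zeros, and survive the
limit. -/
lemma logDeriv_ofReal (hf : NegZerosOfGrowth σ f) (hσ : σ < 1) {x : ℝ} (hx : 0 ≤ x) :
    (logDeriv f (x : ℂ)).im = 0 ∧ 0 ≤ (logDeriv f (x : ℂ)).re ∧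
      x * (logDeriv f (x : ℂ)).re ≤ Real.log ‖f x / f 0‖ := by
  obtain ⟨s, hs, -, hlim, hlog⟩ := hf.exists_seq_negRootPoly hσ
  have h1 := hlog (x : ℂ) (by simpa using hx)
  have hre := (Complex.continuous_re.tendsto _).comp h1
  have him := (Complex.continuous_im.tendsto _).comp h1
  have e : ∀ n, logDeriv (negRootPoly (s n)) (x : ℂ) =
      (((s n).map fun a => 1 / (x + a)).sum : ℝ) := fun n => logDeriv_negRootPoly (hs n) hx
  have hne : f x / f 0 ≠ 0 := div_ne_zero (hf.ne_zero_of_re_nonneg (by simpa using hx))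
    (hf.ne_zero_of_re_nonneg (by simp))
  refine ⟨?_, ?_, ?_⟩
  · refine tendsto_nhds_unique him ?_
    simp [Function.comp_def, e, -Complex.ofReal_sum]
  · refine ge_of_tendsto' hre fun n => ?_
    simp only [Function.comp_apply, e, Complex.ofReal_re]
    refine Multiset.sum_nonneg fun y hy => ?_
    obtain ⟨a, ha, rfl⟩ := Multiset.mem_map.1 hy
    have := hs n a ha
    positivity
  · refine le_of_tendsto_of_tendsto' (hre.const_mul x)
      (((hlim x).norm).log (norm_ne_zero_iff.2 hne)) fun n => ?_
    simp only [Function.comp_apply, e, Complex.ofReal_re]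
    exact mul_sum_inv_le_log_norm_negRootPoly (hs n) hx

/-- The cofactor `g` belongs to the same class, so its contribution to `f' / f` is nonnegative. This
avoids interchanging limit and integral. -/
lemma sum_inv_le_logDeriv (hf : NegZerosOfGrowth σ f) (hσ : σ < 1) {s : Multiset ℝ}
    (hs : ∀ a ∈ s, 0 < a) {g : ℂ → ℂ} (hg : NegZerosOfGrowth σ g)
    (hfg : ∀ z, f z = negRootPoly s z * g z) {x : ℝ} (hx : 0 ≤ x) :
    (s.map fun a => 1 / (x + a)).sum ≤ (logDeriv f (x : ℂ)).re := by
  have hx' : 0 ≤ (x : ℂ).re := by simpa using hx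
  have hP : negRootPoly s (x : ℂ) ≠ 0 := fun h0 =>
    hf.ne_zero_of_re_nonneg hx' (by rw [hfg, h0, zero_mul])
  rw [show f = fun z => negRootPoly s z * g z from funext hfg,
    logDeriv_mul (x : ℂ) hP (hg.ne_zero_of_re_nonneg hx') (differentiable_negRootPoly _ _)
      (hg.differentiable _), logDeriv_negRootPoly hs hx, Complex.add_re, Complex.ofReal_re]
  linarith [(hg.logDeriv_ofReal hσ hx).2.1]

-- Near `0` the factor `f' / f` is continuous and `ρ < 1`; at infinity `f' / f ≤ x⁻¹ (x ^ σ + C)`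
-- and `σ < ρ`.
open MeasureTheory in
lemma integrableOn_logDeriv_mul_rpow (hf : NegZerosOfGrowth σ f) (hσ0 : 0 < σ) {ρ : ℝ}
    (hσ : σ < ρ) (hρ : ρ < 1) :
    IntegrableOn (fun x : ℝ => (logDeriv f (x : ℂ)).re * x ^ (-ρ)) (Set.Ioi 0) := by
  have hdf : Differentiable ℂ (deriv f) := by
    rw [← differentiableOn_univ]
    exact hf.differentiable.differentiableOn.deriv isOpen_univ
  have hcont : ContinuousOn (fun x : ℝ => (logDeriv f (x : ℂ)).re) (Set.Ici 0) := by
    refine Complex.continuous_re.comp_continuousOn ?_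
    simp only [logDeriv_apply]
    refine (hdf.continuous.comp Complex.continuous_ofReal).continuousOn.div
      (hf.differentiable.continuous.comp Complex.continuous_ofReal).continuousOn fun x hx => ?_
    exact hf.ne_zero_of_re_nonneg (by simpa using hx)
  obtain ⟨r₀, hr₀⟩ := Filter.eventually_atTop.1 (hf.growth.and (Filter.eventually_gt_atTop 0))
  have hr₀pos : 0 < r₀ := (hr₀ r₀ le_rfl).2
  rw [← Set.Ioc_union_Ioi_eq_Ioi hr₀pos.le]
  refine IntegrableOn.union ?_ ?_
  · have h1 : IntegrableOn (fun x : ℝ => x ^ (-ρ)) (Set.Icc 0 r₀) := by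
      rw [integrableOn_Icc_iff_integrableOn_Ioc]
      exact (intervalIntegral.intervalIntegrable_rpow' (by linarith)).1
    exact (h1.continuousOn_mul (hcont.mono Set.Icc_subset_Ici_self) isCompact_Icc).mono_set
      Set.Ioc_subset_Icc_self
  · have i1 : IntegrableOn (fun x : ℝ => x ^ (σ - 1 - ρ)) (Set.Ioi r₀) :=
      integrableOn_Ioi_rpow_of_lt (by linarith) hr₀pos
    have i2 : IntegrableOn (fun x : ℝ => x ^ (-1 - ρ)) (Set.Ioi r₀) :=
      integrableOn_Ioi_rpow_of_lt (by linarith) hr₀pos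
    refine (i1.add (i2.const_mul (|Real.log ‖f 0‖|))).mono' ?_ ?_
    · refine ContinuousOn.aestronglyMeasurable ?_ measurableSet_Ioi
      refine (hcont.mono fun x hx => (hr₀pos.trans hx).le).mul ?_
      exact fun x hx => (Real.continuousAt_rpow_const _ _
        (Or.inl (hr₀pos.trans hx).ne')).continuousWithinAt
    · filter_upwards [ae_restrict_mem measurableSet_Ioi] with x hx
      have hxr : r₀ < x := hx
      have hx0 : 0 < x := hr₀pos.trans hxr
      obtain ⟨-, h1, h2⟩ := hf.logDeriv_ofReal (hσ.trans hρ) hx0.le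
      have h3 := (hr₀ x hxr.le).1 (x : ℂ) (by simp [abs_of_pos hx0])
      have hfx : 0 < ‖f x‖ := norm_pos_iff.2 (hf.ne_zero_of_re_nonneg (by simpa using hx0.le))
      have hf0 : 0 < ‖f 0‖ := norm_pos_iff.2 (hf.ne_zero_of_re_nonneg (by simp))
      rw [norm_div, Real.log_div hfx.ne' hf0.ne'] at h2
      have h4 : Real.log ‖f x‖ ≤ x ^ σ := (Real.log_le_iff_le_exp hfx).2 h3
      have h5 : (logDeriv f (x : ℂ)).re ≤ x⁻¹ * (x ^ σ + |Real.log ‖f 0‖|) := by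
        rw [← div_eq_inv_mul, le_div_iff₀ hx0]
        linarith [neg_abs_le (Real.log ‖f 0‖)]
      have hp : 0 < x ^ (-ρ) := Real.rpow_pos_of_pos hx0 _
      rw [Real.norm_of_nonneg (mul_nonneg h1 hp.le)]
      refine (mul_le_mul_of_nonneg_right h5 hp.le).trans (le_of_eq ?_)
      simp only [Pi.add_apply]
      rw [show σ - 1 - ρ = -1 + σ + -ρ by ring, show -1 - ρ = -1 + -ρ by ring,
        Real.rpow_add hx0, Real.rpow_add hx0, Real.rpow_add hx0, Real.rpow_neg_one]
      ring

end NegZerosOfGrowth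

/-! ### The bound for products and passage to the limit. -/

-- The constant of the one-factor inequality does not depend on `a`, and both sides are additive
-- over the zeros.
open MeasureTheory in
lemma integrableOn_and_log_norm_negRootPoly_le {ρ : ℝ} (hρ : 0 < ρ) (hρ' : ρ < 1) {s : Multiset ℝ}
    (hs : ∀ a ∈ s, 0 < a) {z : ℂ} (hz : |z.arg| < Real.pi / 2) :
    IntegrableOn (fun x : ℝ => (s.map fun a => 1 / (x + a)).sum * x ^ (-ρ)) (Set.Ioi 0) ∧
    Real.log ‖negRootPoly s z‖ ≤ (ρ / Real.exp 1) ^ ρ * ‖z‖ ^ ρ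
            / (Real.cos (Complex.arg z) ^ (1 - ρ) * Real.Gamma (1 + ρ)) *
        ∫ x in Set.Ioi (0 : ℝ), (s.map fun a => 1 / (x + a)).sum * x ^ (-ρ) := by
  have hre : 0 ≤ z.re := Complex.abs_arg_le_pi_div_two_iff.1 hz.le
  induction s using Multiset.induction with
  | empty => simp
  | cons a s ih =>
    have hs' : ∀ b ∈ s, 0 < b := fun b hb => hs b (Multiset.mem_cons_of_mem hb)
    have ha := hs a (Multiset.mem_cons_self a s)
    obtain ⟨hi, hl⟩ := ih hs'
    have hia := (integrableOn_and_integral_rpow_neg_div_add hρ hρ' ha).1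
    have e : ∀ x : ℝ, ((a ::ₘ s).map fun a => 1 / (x + a)).sum * x ^ (-ρ) =
        x ^ (-ρ) / (x + a) + (s.map fun a => 1 / (x + a)).sum * x ^ (-ρ) := by
      intro x
      rw [Multiset.map_cons, Multiset.sum_cons]
      ring
    simp only [e]
    refine ⟨hia.add hi, ?_⟩
    have h1 := norm_one_add_div_mono ha hre
    have h2 := norm_negRootPoly_mono hs' hre
    rw [integral_add hia hi, negRootPoly_cons, norm_mul, mul_add,
      Real.log_mul (by linarith [h1.1, h1.2]) (by linarith [h2.1, h2.2])]
    exact add_le_add (log_norm_one_add_div_le hρ hρ' ha hz) hl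

theorem theorem1 (f : ℂ → ℂ) (hf : Differentiable ℂ f)
    (ρ₀ : ℝ) (hρ₀ : 0 ≤ ρ₀) (hρ₀' : ρ₀ < 1)
    (horder : growthOrder f = (ρ₀ : EReal))
    (hzeros : ∀ w : ℂ, f w = 0 → ∃ x : ℝ, x < 0 ∧ w = (x : ℂ))
    (ρ : ℝ) (hρ : ρ₀ < ρ) (hρ' : ρ < 1) :
    ∃ I : ℝ,
      MeasureTheory.IntegrableOn
        (fun x : ℝ => deriv f (x : ℂ) / f (x : ℂ) * ((x ^ (-ρ) : ℝ) : ℂ)) (Set.Ioi (0 : ℝ)) ∧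
      (∫ x in Set.Ioi (0 : ℝ), deriv f (x : ℂ) / f (x : ℂ) * ((x ^ (-ρ) : ℝ) : ℂ)) = (I : ℂ) ∧
      ∀ z : ℂ, |Complex.arg z| < Real.pi / 2 →
        1 ≤ ‖f (z.re : ℂ) / f 0‖ ∧
        ‖f (z.re : ℂ) / f 0‖ ≤ ‖f z / f 0‖ ∧
        ‖f z / f 0‖ ≤
          Real.exp ((ρ / Real.exp 1) ^ ρ * ‖z‖ ^ ρ
            / (Real.cos (Complex.arg z) ^ (1 - ρ) * Real.Gamma (1 + ρ)) * I) := by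
  -- The midpoint lies strictly between `ρ₀` and `ρ`, leaving room for the growth bound and for
  -- convergence, and is positive even if `ρ₀ = 0`.
  have hσρ : (ρ₀ + ρ) / 2 < ρ := by linarith
  have hρ0 : 0 < ρ := by linarith
  have hσ1 : (ρ₀ + ρ) / 2 < 1 := by linarith
  have hF : NegZerosOfGrowth ((ρ₀ + ρ) / 2) f := ⟨hf, hzeros,
    eventually_norm_le_of_growthOrder_lt hf.continuous
      (by rw [horder]; exact EReal.coe_lt_coe_iff.2 (by linarith))⟩
  have hint := hF.integrableOn_logDeriv_mul_rpow (by linarith) hσρ hρ'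
  have heq : Set.EqOn (fun x : ℝ => (((logDeriv f (x : ℂ)).re * x ^ (-ρ) : ℝ) : ℂ))
      (fun x : ℝ => deriv f (x : ℂ) / f (x : ℂ) * ((x ^ (-ρ) : ℝ) : ℂ)) (Set.Ioi 0) := by
    intro x hx
    have him := (hF.logDeriv_ofReal hσ1 (le_of_lt hx)).1
    simp only
    rw [← logDeriv_apply, Complex.ofReal_mul]
    congr 1
    exact Complex.ext (by simp) (by simp [him])
  refine ⟨∫ x in Set.Ioi (0 : ℝ), (logDeriv f (x : ℂ)).re * x ^ (-ρ),
    MeasureTheory.IntegrableOn.congr_fun hint.ofReal heq measurableSet_Ioi, ?_, fun z hz => ?_⟩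
  · rw [← MeasureTheory.setIntegral_congr_fun measurableSet_Ioi heq]
    exact integral_ofReal
  · obtain ⟨s, hs, hsg, hlim, -⟩ := hF.exists_seq_negRootPoly hσ1
    have hre : 0 ≤ z.re := Complex.abs_arg_le_pi_div_two_iff.1 hz.le
    refine ⟨ge_of_tendsto' (hlim _).norm fun n => (norm_negRootPoly_mono (hs n) hre).1,
      le_of_tendsto_of_tendsto' (hlim _).norm (hlim z).norm
        fun n => (norm_negRootPoly_mono (hs n) hre).2,
      le_of_tendsto' (hlim z).norm fun n => ?_⟩
    obtain ⟨g, hg, hfg⟩ := hsg n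
    obtain ⟨hi, hl⟩ := integrableOn_and_log_norm_negRootPoly_le hρ0 hρ' (hs n) hz
    have hpos : 0 < ‖negRootPoly (s n) z‖ := by
      linarith [(norm_negRootPoly_mono (hs n) hre).1, (norm_negRootPoly_mono (hs n) hre).2]
    refine (Real.log_le_iff_le_exp hpos).1 (hl.trans (mul_le_mul_of_nonneg_left ?_ ?_))
    · refine MeasureTheory.setIntegral_mono_on hi hint measurableSet_Ioi fun x hx => ?_
      have hx : (0 : ℝ) < x := hx
      exact mul_le_mul_of_nonneg_right (hF.sum_inv_le_logDeriv hσ1 (hs n) hg hfg hx.le)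
        (Real.rpow_nonneg hx.le _)
    · have hc : 0 < Real.cos z.arg := Real.cos_pos_of_mem_Ioo (abs_lt.1 hz)
      have hG : 0 < Real.Gamma (1 + ρ) := Real.Gamma_pos_of_pos (by linarith)
      positivity
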